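/- Let $R$ be a finite chain ring of length $2$ (an associative, not necessarily commutative, finite ring with $1\neq 0$ whose left ideals and whose right ideals are linearly ordered by inclusion, and whose Jacobson radical $N$ satisfies $N\neq 0$, $N^2=0$), and let $q=|R/N|$ be the order of its residue field. Let $\mathrm{PHG}(2,R)$ be the right projective Hjelmslev plane over $R$: its points and lines are the free submodules of rank $1$ and rank $2$, respectively, of the right module $R^3_R$, and incidence is inclusion. A projective $(k,n)$-arc is a set of exactly $k$ points such that every line contains at most $n$ of them, and $\mathrm{m}_n(R)$ denotes the largest $k$ for which a projective $(k,n)$-arc exists in $\mathrm{PHG}(2,R)$. Then there exists a projective $(q^4-q^2-q,\;q^2-1)$-arc in $\mathrm{PHG}(2,R)$; equivalently, $\mathrm{m}_n(R)\geq q(q+1)n-q^3$ for $n=q^2-1$. -/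

import Mathlib

/-- A (not necessarily commutative) ring is a *chain ring* if its left ideals and its right ideals
are both totally ordered by inclusion. Right ideals are the `Rᵐᵒᵖ`-submodules of `R`. -/
structure IsChainRing (R : Type*) [Ring R] : Prop where
  nontrivial : Nontrivial R
  left_total : ∀ I J : Submodule R R, I ≤ J ∨ J ≤ I
  right_total : ∀ I J : Submodule Rᵐᵒᵖ R, I ≤ J ∨ J ≤ I

/-- A chain ring of length (nilpotency index) two: the Jacobson radical `N = rad R`
satisfies `N ^ 2 = 0` (all products of two elements of `N` vanish) and `N ≠ 0`. -/
structure IsChainRingOfLengthTwo (R : Type*) [Ring R] : Prop extends IsChainRing R where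
  rad_sq : ∀ x ∈ Ring.jacobson R, ∀ y ∈ Ring.jacobson R, x * y = 0
  rad_ne : Ring.jacobson R ≠ ⊥

namespace PHG

/-- The submodule `S` of the right `R`-module `R³` is free of rank `k`, that is, it has a basis
of `k` elements. Right `R`-modules are modules over `Rᵐᵒᵖ`. -/
def IsFreeOfRank {R : Type*} [Ring R] (k : ℕ) (S : Submodule Rᵐᵒᵖ (Fin 3 → R)) : Prop :=
  Nonempty (Module.Basis (Fin k) Rᵐᵒᵖ S)

/-- Points of the right projective Hjelmslev plane over `R`:
the free rank one submodules of the right module `R³`. -/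
def Point (R : Type*) [Ring R] : Type _ :=
  {x : Submodule Rᵐᵒᵖ (Fin 3 → R) // IsFreeOfRank 1 x}

/-- Lines of the right projective Hjelmslev plane over `R`:
the free rank two submodules of the right module `R³`. -/
def Line (R : Type*) [Ring R] : Type _ :=
  {L : Submodule Rᵐᵒᵖ (Fin 3 → R) // IsFreeOfRank 2 L}

/-- The set of points incident with a line; incidence is inclusion of submodules. -/
def Line.points {R : Type*} [Ring R] (L : Line R) : Set (Point R) :=
  {x | x.1 ≤ L.1}

/-- The multiplicity `K(S) = ∑_{x ∈ S} K(x)` of a set `S` of points in the multiset `K`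
(the sum is finite when `R` is finite). -/
noncomputable def pointCount {R : Type*} [Ring R] (K : Point R → ℕ) (S : Set (Point R)) : ℕ :=
  ∑ᶠ x ∈ S, K x

/-- The multiset `K` of points is a `(k, n)`-arc: it has cardinality `k`, and every line has
multiplicity at most `n`. -/
def IsArc {R : Type*} [Ring R] (K : Point R → ℕ) (k n : ℕ) : Prop :=
  pointCount K Set.univ = k ∧ ∀ L : Line R, pointCount K L.points ≤ n

/-- The multiset `K` of points is projective, that is, a set of points. -/
def IsProjective {R : Type*} [Ring R] (K : Point R → ℕ) : Prop :=
  ∀ x, K x = 0 ∨ K x = 1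

/-- The number `m_n(R)`: the largest `k` for which a projective `(k, n)`-arc exists
in the right projective Hjelmslev plane over the finite ring `R`. -/
noncomputable def maxArcSize (R : Type*) [Ring R] (n : ℕ) : ℕ :=
  sSup {k : ℕ | ∃ K : Point R → ℕ, IsProjective K ∧ IsArc K k n}

end PHG

/-! The plane has q²(q² + q + 1) points and each line has q² + q, so the task is to remove q(q + 1)²
points such that every line loses at least q + 1. Reduction modulo N maps the plane onto PG(2, q). A
residue class of points is an affine plane of order q, and a line over the class meets it in a
segment whose direction depends only on the residue of the line. Give the lines xᵢ = 0 of PG(2, q)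
multiplicity 1 and the diagonal x₀ + x₁ + x₂ = 0 multiplicity q - 2. Over each class remove as many
parallel segments as the multiplicities through it add up to, all in the direction of one of these
lines (`exists_form`).

A line whose residue is none of the four meets them with total multiplicity q + 1 and crosses each
removed segment once, so it loses exactly q + 1 points (`lineCard_le_of_generic`). A line over the
diagonal loses q - 1 points in each of the three classes where the diagonal meets an axis, and 3(q -
1) ≥ q + 1 (`lineCard_le_of_diagonal`). A line over an axis loses 2 points at one vertex; the
segments are placed so that it also loses a whole class of q points (`exists_not_good`,
`lineCard_le_of_axis`).

Points are counted through their generators, q² - q for each. Writing a vector as s(c) + τ(d) with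
c, d in F³ makes both incidence and membership in the arc linear conditions on d. -/

/-- Coordinates on a chain ring `R` of length two with residue field `F`: the residue map `π`, a
section `s` of it, and a parametrization `τ` of the radical by `F` that is linear for the left
action of `R`. -/
structure ResidueSystem (R F : Type*) [Ring R] [Field F] where
  π : R →+* F
  s : F → R
  τ : F →+ R
  π_s : ∀ c, π (s c) = c
  s_zero : s 0 = 0
  π_τ : ∀ d, π (τ d) = 0
  τ_injective : Function.Injective τ
  exists_τ : ∀ x, π x = 0 → ∃ d, τ d = x
  mul_τ : ∀ r d, r * τ d = τ (π r * d)
  isUnit : ∀ x, π x ≠ 0 → IsUnit x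

/-! ### Residue field and radical of a chain ring of length two. -/

namespace IsChainRingOfLengthTwo

variable {R : Type*} [Ring R]

/-- A maximal left ideal missing `x` is comparable with `Rx`, which forces `Rx = R`; finiteness
makes the left inverse two-sided. -/
theorem isUnit_of_notMem [Finite R] (hR : IsChainRingOfLengthTwo R) {x : R} (hx : x ∉ Ring.jacobson R) :
    IsUnit x := by
  rw [Ring.jacobson_eq_sInf_isMaximal, Submodule.mem_sInf] at hx
  push Not at hx
  obtain ⟨M, hM, hxM⟩ := hx
  have hM' : Ideal.IsMaximal M := hM
  have htop : Ideal.span {x} = ⊤ := by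
    by_contra h
    rcases hR.left_total M (Ideal.span {x}) with h1 | h1
    · exact hxM ((hM'.eq_of_le h h1) ▸ Ideal.mem_span_singleton_self x)
    · exact hxM (h1 (Ideal.mem_span_singleton_self x))
  have h1 : (1 : R) ∈ Ideal.span {x} := htop ▸ Submodule.mem_top
  obtain ⟨y, hy⟩ := Ideal.mem_span_singleton'.1 h1
  exact ⟨⟨x, y, mul_eq_one_comm.1 hy, hy⟩, rfl⟩

theorem one_notMem (hR : IsChainRingOfLengthTwo R) : (1 : R) ∉ Ring.jacobson R := by
  intro h
  have := hR.nontrivial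
  exact (one_ne_zero : (1 : R) ≠ 0) (by simpa using hR.rad_sq 1 h 1 h)

/-- Any nonzero `θ` of the radical serves: if `θ = r * y` with `y` in the radical, then `N² = 0`
forces `r` to be a unit. -/
theorem exists_generator [Finite R] (hR : IsChainRingOfLengthTwo R) :
    ∃ θ ∈ Ring.jacobson R, θ ≠ 0 ∧ (∀ y ∈ Ring.jacobson R, ∃ r, r * θ = y) ∧
      ∀ r, r * θ = 0 ↔ r ∈ Ring.jacobson R := by
  obtain ⟨θ, hθ, h0⟩ := Submodule.exists_mem_ne_zero_of_ne_bot hR.rad_ne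
  refine ⟨θ, hθ, h0, fun y hy => ?_, fun r => ⟨fun h => ?_, fun h => hR.rad_sq r h θ hθ⟩⟩
  · rcases hR.left_total (Ideal.span {y}) (Ideal.span {θ}) with h | h
    · exact Ideal.mem_span_singleton'.1 (h (Ideal.mem_span_singleton_self y))
    · obtain ⟨r, hr⟩ := Ideal.mem_span_singleton'.1 (h (Ideal.mem_span_singleton_self θ))
      by_cases hrJ : r ∈ Ring.jacobson R
      · exact absurd (hr.symm.trans (hR.rad_sq r hrJ y hy)) h0
      · obtain ⟨u, rfl⟩ := hR.isUnit_of_notMem hrJ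
        exact ⟨↑u⁻¹, by rw [← hr, Units.inv_mul_cancel_left]⟩
  · by_contra hr
    obtain ⟨u, rfl⟩ := hR.isUnit_of_notMem hr
    exact h0 (by simpa using h)

/-- Take `τ d = s d * θ`. The left annihilator of `θ` is the radical, so the product depends only on
the residue of the left factor; this makes `τ` additive and left linear although `s` is neither. -/
theorem exists_residueSystem [Finite R] (hR : IsChainRingOfLengthTwo R) :
    ∃ _ : Field (R ⧸ Ring.jacobson R), Nonempty (ResidueSystem R (R ⧸ Ring.jacobson R)) := by
  obtain ⟨θ, hθ, h0, hgen, hann⟩ := hR.exists_generator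
  have hfin : Finite (R ⧸ Ring.jacobson R) := Quotient.finite _
  have hnt : Nontrivial (R ⧸ Ring.jacobson R) :=
    Ideal.Quotient.nontrivial_iff.2 fun h => hR.one_notMem (h ▸ Submodule.mem_top)
  let D : DivisionRing (R ⧸ Ring.jacobson R) := DivisionRing.ofIsUnitOrEqZero fun a => by
    obtain ⟨x, rfl⟩ := Ideal.Quotient.mk_surjective a
    by_cases hx : x ∈ Ring.jacobson R
    · exact Or.inr (Ideal.Quotient.eq_zero_iff_mem.2 hx)
    · exact Or.inl ((hR.isUnit_of_notMem hx).map _)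
  let K : Field (R ⧸ Ring.jacobson R) := littleWedderburn _
  let π : R →+* R ⧸ Ring.jacobson R := Ideal.Quotient.mk _
  have hπ : ∀ x, π x = 0 ↔ x ∈ Ring.jacobson R := fun x => Ideal.Quotient.eq_zero_iff_mem
  have hsurj : Function.Surjective π := Ideal.Quotient.mk_surjective
  have hex : ∀ c, ∃ x, π x = c ∧ (c = 0 → x = 0) := fun c => by
    by_cases hc : c = 0
    · exact ⟨0, by rw [hc, map_zero], fun _ => rfl⟩
    · obtain ⟨x, hx⟩ := hsurj c
      exact ⟨x, hx, fun h => absurd h hc⟩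
  choose s hs hs0 using hex
  have hcongr : ∀ x y, π x = π y → x * θ = y * θ := fun x y h => by
    rw [← sub_eq_zero, ← sub_mul, hann, ← hπ, map_sub, h, sub_self]
  refine ⟨K, ⟨⟨π, s, ⟨⟨fun d => s d * θ, by simp [hs0 0 rfl]⟩, fun c d => ?_⟩, hs, hs0 0 rfl,
    fun d => ?_, fun c d h => ?_, fun x hx => ?_, fun r d => ?_, fun x hx => ?_⟩⟩⟩
  · change s (c + d) * θ = s c * θ + s d * θ
    rw [← add_mul]
    exact hcongr _ _ (by rw [map_add, hs, hs, hs])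
  · change π (s d * θ) = 0
    rw [map_mul, (hπ θ).2 hθ, mul_zero]
  · change s c * θ = s d * θ at h
    rw [← sub_eq_zero, ← sub_mul, hann, ← hπ, map_sub, hs, hs] at h
    exact sub_eq_zero.1 h
  · obtain ⟨r, hr⟩ := hgen x ((hπ x).1 hx)
    exact ⟨π r, (hcongr _ _ (hs _)).trans hr⟩
  · change r * (s d * θ) = s (π r * d) * θ
    rw [← mul_assoc]
    exact hcongr _ _ (by rw [map_mul, hs, hs])
  · exact hR.isUnit_of_notMem fun h => hx ((hπ x).2 h)

end IsChainRingOfLengthTwo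

/-! ### Counting solutions of linear equations over the residue field. -/

open scoped Classical in
theorem card_fiber_mul_card {V W : Type*} [AddCommGroup V] [AddCommGroup W] [Fintype V] [Fintype W]
    (f : V →+ W) (hf : Function.Surjective f) (b : W) :
    (Finset.univ.filter fun x => f x = b).card * Fintype.card W = Fintype.card V := by
  have h := Finset.card_eq_sum_card_fiberwise (f := f) (s := Finset.univ) (t := Finset.univ)
    (by simp)
  rw [Finset.card_univ] at h
  rw [h, Finset.sum_congr rfl fun c _ => AddMonoidHom.card_fiber_eq_of_mem_range f
    (hf c) (hf b), Finset.sum_const, Finset.card_univ, smul_eq_mul, mul_comm]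

namespace FieldCount

variable {F : Type*} [Field F] [Fintype F] {u v : Fin 3 → F}

open scoped Classical in
theorem card_dot (hu : u ≠ 0) (a : F) :
    (Finset.univ.filter fun d => u ⬝ᵥ d = a).card = Fintype.card F ^ 2 := by
  obtain ⟨i, hi⟩ := Function.ne_iff.1 hu
  have hsurj : Function.Surjective (dotProductBilin F F u : (Fin 3 → F) →ₗ[F] F) := fun b =>
    ⟨Pi.single i ((u i)⁻¹ * b), by
      change u ⬝ᵥ _ = b
      rw [dotProduct_single, mul_inv_cancel_left₀ hi]⟩
  have h := card_fiber_mul_card (dotProductBilin F F u : (Fin 3 → F) →ₗ[F] F).toAddMonoidHom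
    hsurj a
  rw [Fintype.card_fun, Fintype.card_fin, pow_succ] at h
  exact Nat.eq_of_mul_eq_mul_right Fintype.card_pos h

open scoped Classical in
theorem card_dot_pair (h : LinearIndependent F ![u, v]) (a b : F) :
    (Finset.univ.filter fun d => u ⬝ᵥ d = a ∧ v ⬝ᵥ d = b).card = Fintype.card F := by
  let M : Matrix (Fin 2) (Fin 3) F := Matrix.of ![u, v]
  have hrank : M.rank = 2 := by
    have : LinearIndependent F M.row := h
    simpa using this.rank_matrix
  have hsurj : Function.Surjective M.mulVecLin := by
    rw [← LinearMap.range_eq_top]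
    apply Submodule.eq_top_of_finrank_eq
    rw [Module.finrank_fin_fun]
    exact hrank
  have h := card_fiber_mul_card M.mulVecLin.toAddMonoidHom hsurj ![a, b]
  rw [Fintype.card_fun, Fintype.card_fun, Fintype.card_fin, Fintype.card_fin,
    show Fintype.card F ^ 3 = Fintype.card F * Fintype.card F ^ 2 from pow_succ' _ 2] at h
  rw [← Nat.eq_of_mul_eq_mul_right (pow_pos (Fintype.card_pos (α := F)) 2) h]
  congr 1
  ext d
  simp only [Finset.mem_filter, Finset.mem_univ, true_and, LinearMap.toAddMonoidHom_coe,
    Matrix.mulVecLin_apply, funext_iff, Fin.forall_fin_two]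
  rfl

open scoped Classical in
theorem card_dot_mem (hv : v ≠ 0) (B : Finset F) :
    (Finset.univ.filter fun d => v ⬝ᵥ d ∈ B).card = Fintype.card F ^ 2 * B.card := by
  rw [Finset.card_eq_sum_card_fiberwise (f := fun d => v ⬝ᵥ d) (t := B)
    (fun d hd => by simpa using hd)]
  rw [Finset.sum_congr rfl fun b hb => ?_, Finset.sum_const, smul_eq_mul, mul_comm]
  rw [← card_dot hv b, Finset.filter_filter]
  congr 1
  ext d
  simp only [Finset.mem_filter, Finset.mem_univ, true_and]
  exact ⟨fun h => h.2, fun h => ⟨h ▸ hb, h⟩⟩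

open scoped Classical in
theorem card_dot_pair_mem (h : LinearIndependent F ![u, v]) (a : F) (B : Finset F) :
    (Finset.univ.filter fun d => u ⬝ᵥ d = a ∧ v ⬝ᵥ d ∈ B).card = Fintype.card F * B.card := by
  rw [Finset.card_eq_sum_card_fiberwise (f := fun d => v ⬝ᵥ d) (t := B)
    (fun d hd => by simpa using (Finset.mem_filter.1 hd).2.2)]
  rw [Finset.sum_congr rfl fun b hb => ?_, Finset.sum_const, smul_eq_mul, mul_comm]
  rw [← card_dot_pair h a b, Finset.filter_filter]
  congr 1
  ext d
  simp only [Finset.mem_filter, Finset.mem_univ, true_and]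
  exact ⟨fun h => ⟨h.1.1, h.2⟩, fun h => ⟨⟨h.1, h.2 ▸ hb⟩, h.2⟩⟩

open scoped Classical in
theorem card_ne_zero_filter_add_one (p : (Fin 3 → F) → Prop) [DecidablePred p]
    (h0 : p 0) :
    (Finset.univ.filter fun c => c ≠ 0 ∧ p c).card + 1 =
      (Finset.univ.filter fun c => p c).card := by
  rw [← Finset.card_erase_add_one (s := Finset.univ.filter fun c => p c) (a := 0)
    (by simpa using h0)]
  congr 2
  ext c
  simp

open scoped Classical in
theorem card_ne_zero_dot (hu : u ≠ 0) :
    (Finset.univ.filter fun c => c ≠ 0 ∧ u ⬝ᵥ c = 0).card + 1 = Fintype.card F ^ 2 := by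
  rw [card_ne_zero_filter_add_one (fun c => u ⬝ᵥ c = 0) (dotProduct_zero _), card_dot hu]

open scoped Classical in
theorem card_ne_zero_dot_pair (h : LinearIndependent F ![u, v]) :
    (Finset.univ.filter fun c => c ≠ 0 ∧ u ⬝ᵥ c = 0 ∧ v ⬝ᵥ c = 0).card + 1 = Fintype.card F := by
  rw [card_ne_zero_filter_add_one (fun c => u ⬝ᵥ c = 0 ∧ v ⬝ᵥ c = 0) (by simp),
    card_dot_pair h]

end FieldCount

/-! ### Vectors in coordinates, and the shape of the arc over each residue class. -/

namespace ResidueSystem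

variable {R F : Type*} [Ring R] [Field F] (S : ResidueSystem R F)

/-- A generator of the radical. -/
def θ : R := S.τ 1

/-- The coordinatewise residue of a vector. -/
def residue (x : Fin 3 → R) : Fin 3 → F := fun i => S.π (x i)

/-- The vector with residue `c` and radical part `d`. -/
def lift (c d : Fin 3 → F) : Fin 3 → R := fun i => S.s (c i) + S.τ (d i)

/-- The generators of the points of the arc, a point set of the plane whose complement meets every
line in at least `q + 1` points. Over a residue class `c` of points, the complement has as many
parallel segments as there are lines through `c` among `x₀ = 0`, `x₁ = 0`, `x₂ = 0` (each counted
once) and `x₀ + x₁ + x₂ = 0` (counted `q - 2` times). -/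
def Good (x : Fin 3 → R) : Prop :=
  S.residue x ≠ 0 ∧
  (∀ i, S.residue x i = 0 → S.residue x (i + 1) = 0 → x i ≠ 0 ∧ x i ≠ S.θ * x (i + 2)) ∧
  (∀ i, S.residue x i = 0 → S.residue x (i + 1) ≠ 0 → S.residue x (i + 2) ≠ 0 →
    S.residue x (i + 1) + S.residue x (i + 2) ≠ 0 → x i ≠ 0) ∧
  (∀ i, S.residue x i = 0 → S.residue x (i + 1) ≠ 0 → S.residue x (i + 2) ≠ 0 →
    S.residue x (i + 1) + S.residue x (i + 2) = 0 → x i = S.θ * x (i + 2)) ∧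
  ((∀ i, S.residue x i ≠ 0) → S.residue x 0 + S.residue x 1 + S.residue x 2 = 0 →
    x 0 + x 1 + x 2 = 0 ∨ x 0 + x 1 + x 2 = S.θ * x 0)

theorem τ_eq_zero {d : F} : S.τ d = 0 ↔ d = 0 := map_eq_zero_iff _ S.τ_injective

theorem τ_mul_τ (d e : F) : S.τ d * S.τ e = 0 := by
  rw [S.mul_τ, S.π_τ, zero_mul, map_zero]

theorem θ_mul_τ (d : F) : S.θ * S.τ d = 0 := S.τ_mul_τ 1 d

theorem θ_mul_eq_zero {r : R} : S.θ * r = 0 ↔ S.π r = 0 := by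
  constructor
  · intro h
    by_contra hr
    obtain ⟨u, rfl⟩ := S.isUnit r hr
    rw [Units.mul_left_eq_zero, θ, S.τ_eq_zero] at h
    exact one_ne_zero h
  · intro h
    obtain ⟨d, rfl⟩ := S.exists_τ r h
    exact S.θ_mul_τ d

theorem residue_lift (c d : Fin 3 → F) : S.residue (S.lift c d) = c := by
  ext i
  simp [residue, lift, S.π_s, S.π_τ]

theorem lift_bijective :
    Function.Bijective fun p : (Fin 3 → F) × (Fin 3 → F) => S.lift p.1 p.2 := by
  constructor
  · rintro ⟨c, d⟩ ⟨c', d'⟩ h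
    dsimp only at h
    have hc : c = c' := by rw [← S.residue_lift c d, h, S.residue_lift]
    subst hc
    refine Prod.ext rfl (funext fun i => ?_)
    exact S.τ_injective (add_left_cancel (congrFun h i))
  · intro x
    have hex : ∀ i, ∃ d, S.τ d = x i - S.s (S.π (x i)) := fun i =>
      S.exists_τ _ (by rw [map_sub, S.π_s, sub_self])
    choose d hd using hex
    refine ⟨(S.residue x, d), funext fun i => ?_⟩
    simp [lift, hd, residue]

theorem dotProduct_lift (u : Fin 3 → R) (c d : Fin 3 → F) :
    u ⬝ᵥ S.lift c d = (u ⬝ᵥ fun i => S.s (c i)) + S.τ (S.residue u ⬝ᵥ d) := by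
  simp only [dotProduct, lift, mul_add, Finset.sum_add_distrib, S.mul_τ, map_sum, residue]

theorem π_dotProduct (u x : Fin 3 → R) : S.π (u ⬝ᵥ x) = S.residue u ⬝ᵥ S.residue x := by
  simp only [dotProduct, map_sum, map_mul, residue]

/-- Left linearity of `τ` moves `u` inside as its residue, and the constant term is radical because
of `h`. Hence a line over the class `c` is an affine plane in `d` with normal vector `S.residue u`.
-/
theorem exists_dotProduct_lift_eq_zero_iff (u : Fin 3 → R) {c : Fin 3 → F}
    (h : S.residue u ⬝ᵥ c = 0) :
    ∃ a, ∀ d, u ⬝ᵥ S.lift c d = 0 ↔ S.residue u ⬝ᵥ d = a := by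
  obtain ⟨a, ha⟩ := S.exists_τ (-(u ⬝ᵥ fun i => S.s (c i))) (by
    rw [map_neg, S.π_dotProduct, neg_eq_zero, ← h]
    congr 1
    ext i
    exact S.π_s _)
  refine ⟨a, fun d => ?_⟩
  rw [S.dotProduct_lift, ← S.τ_injective.eq_iff, ha, add_comm, eq_neg_iff_add_eq_zero]

/-- The radical coordinate of `θ * r` for `r` of residue `c`. -/
theorem exists_twist (c : F) :
    ∃ b, (∀ d, S.θ * (S.s c + S.τ d) = S.τ b) ∧ (b = 0 ↔ c = 0) := by
  obtain ⟨b, hb⟩ := S.exists_τ (S.θ * S.s c) (by rw [map_mul, θ, S.π_τ, zero_mul])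
  refine ⟨b, fun d => by rw [mul_add, S.θ_mul_τ, add_zero, hb], ?_⟩
  rw [← S.τ_eq_zero, hb, S.θ_mul_eq_zero, S.π_s]

theorem lift_apply_of_eq_zero {c : Fin 3 → F} {i : Fin 3} (h : c i = 0) (d : Fin 3 → F) :
    S.lift c d i = S.τ (d i) := by
  rw [lift, h, S.s_zero, zero_add]

theorem exists_good_vertex [Fintype F] [DecidableEq F] {c : Fin 3 → F} (i : Fin 3)
    (h0 : c i = 0) (h1 : c (i + 1) = 0)
    (h2 : c (i + 2) ≠ 0) :
    ∃ B : Finset F, B.card + 2 = Fintype.card F ∧ ∀ d, S.Good (S.lift c d) ↔ d i ∈ B := by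
  obtain ⟨b, hb, hb0⟩ := S.exists_twist (c (i + 2))
  refine ⟨{0, b}ᶜ, ?_, fun d => ?_⟩
  · rw [← Finset.card_add_card_compl {0, b}, Finset.card_pair (fun h => h2 (hb0.1 h.symm)),
      add_comm]
  · have key : d i ∈ ({0, b}ᶜ : Finset F) ↔
        S.lift c d i ≠ 0 ∧ S.lift c d i ≠ S.θ * S.lift c d (i + 2) := by
      rw [S.lift_apply_of_eq_zero h0, lift, hb, ne_eq, ne_eq, S.τ_eq_zero, S.τ_injective.eq_iff]
      simp
    rw [key, Good, S.residue_lift]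
    have hc : c ≠ 0 := fun h => h2 (congrFun h _)
    fin_cases i <;> simp_all [Fin.forall_fin_succ]

theorem exists_good_edge [Fintype F] [DecidableEq F] {c : Fin 3 → F} (i : Fin 3)
    (h0 : c i = 0) (h1 : c (i + 1) ≠ 0)
    (h2 : c (i + 2) ≠ 0) (hs : c (i + 1) + c (i + 2) ≠ 0) :
    ∃ B : Finset F, B.card + 1 = Fintype.card F ∧ ∀ d, S.Good (S.lift c d) ↔ d i ∈ B := by
  refine ⟨{0}ᶜ, ?_, fun d => ?_⟩
  · rw [← Finset.card_add_card_compl {0}, Finset.card_singleton, add_comm]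
  · have key : d i ∈ ({0}ᶜ : Finset F) ↔ S.lift c d i ≠ 0 := by
      rw [S.lift_apply_of_eq_zero h0, ne_eq, S.τ_eq_zero]
      simp
    rw [key, Good, S.residue_lift]
    have hc : c ≠ 0 := fun h => h2 (congrFun h _)
    fin_cases i <;> simp_all [Fin.forall_fin_succ]

theorem exists_good_crossing {c : Fin 3 → F} (i : Fin 3) (h0 : c i = 0) (h1 : c (i + 1) ≠ 0)
    (h2 : c (i + 2) ≠ 0) (hs : c (i + 1) + c (i + 2) = 0) :
    ∃ B : Finset F, B.card = 1 ∧ ∀ d, S.Good (S.lift c d) ↔ d i ∈ B := by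
  obtain ⟨b, hb, hb0⟩ := S.exists_twist (c (i + 2))
  refine ⟨{b}, rfl, fun d => ?_⟩
  have key : d i ∈ ({b} : Finset F) ↔ S.lift c d i = S.θ * S.lift c d (i + 2) := by
    rw [S.lift_apply_of_eq_zero h0, lift, hb, S.τ_injective.eq_iff]
    simp
  rw [key, Good, S.residue_lift]
  have hc : c ≠ 0 := fun h => h2 (congrFun h _)
  fin_cases i <;> simp_all [Fin.forall_fin_succ]

theorem exists_good_diagonal [DecidableEq F] {c : Fin 3 → F} (h : ∀ i, c i ≠ 0)
    (hs : c 0 + c 1 + c 2 = 0) :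
    ∃ B : Finset F, B.card = 2 ∧ ∀ d, S.Good (S.lift c d) ↔ (1 : Fin 3 → F) ⬝ᵥ d ∈ B := by
  obtain ⟨b, hb, hb0⟩ := S.exists_twist (c 0)
  -- The section is not additive, so the chosen lifts of the `c i` sum to a radical element `τ g`
  -- that may be nonzero; it shifts the two admissible values `0` and `b`.
  obtain ⟨g, hg⟩ := S.exists_τ (S.s (c 0) + S.s (c 1) + S.s (c 2)) (by
    rw [map_add, map_add, S.π_s, S.π_s, S.π_s, hs])
  refine ⟨{-g, b - g}, Finset.card_pair fun e => h 0 (hb0.1 ?_), fun d => ?_⟩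
  · linear_combination -e
  · have hsum : S.lift c d 0 + S.lift c d 1 + S.lift c d 2 =
        S.τ (g + (1 : Fin 3 → F) ⬝ᵥ d) := by
      rw [map_add, hg, one_dotProduct, Fin.sum_univ_three, map_add, map_add]
      simp only [lift]
      abel
    have key : (1 : Fin 3 → F) ⬝ᵥ d ∈ ({-g, b - g} : Finset F) ↔
        S.lift c d 0 + S.lift c d 1 + S.lift c d 2 = 0 ∨
          S.lift c d 0 + S.lift c d 1 + S.lift c d 2 = S.θ * S.lift c d 0 := by
      rw [hsum, show S.θ * S.lift c d 0 = S.τ b from hb _, S.τ_eq_zero, S.τ_injective.eq_iff,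
        Finset.mem_insert, Finset.mem_singleton, eq_sub_iff_add_eq, eq_neg_iff_add_eq_zero,
        add_comm g]
    rw [key, Good, S.residue_lift]
    have hc : c ≠ 0 := fun e => h 0 (congrFun e _)
    simp_all

theorem good_of_generic {c : Fin 3 → F} (h : ∀ i, c i ≠ 0) (hs : c 0 + c 1 + c 2 ≠ 0)
    (d : Fin 3 → F) : S.Good (S.lift c d) := by
  rw [Good, S.residue_lift]
  have hc : c ≠ 0 := fun e => h 0 (congrFun e _)
  simp_all

end ResidueSystem

/-! ### Weights of residue classes, and lines restricted to one class. -/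

namespace ResidueSystem

open FieldCount

variable {R F : Type*} [Ring R] [Field F] (S : ResidueSystem R F)

open scoped Classical in
/-- The number of parallel segments over the residue class `c` that are missing in the arc. -/
noncomputable def weight [Fintype F] (c : Fin 3 → F) : ℕ :=
  (∑ i : Fin 3, if (Pi.single i 1 : Fin 3 → F) ⬝ᵥ c = 0 then 1 else 0) +
    if (1 : Fin 3 → F) ⬝ᵥ c = 0 then Fintype.card F - 2 else 0

open scoped Classical in
theorem weight_eq [Fintype F] (c : Fin 3 → F) :
    weight c = (if c 0 = 0 then 1 else 0) + (if c 1 = 0 then 1 else 0) +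
      (if c 2 = 0 then 1 else 0) + if c 0 + c 1 + c 2 = 0 then Fintype.card F - 2 else 0 := by
  simp only [weight, single_dotProduct, one_mul, one_dotProduct, Fin.sum_univ_three]

/-- The common form of all five cases of `Good`: one linear form in `d`, with one forbidden value
for each unit of weight. -/
theorem exists_form [Fintype F] {c : Fin 3 → F} (hc : c ≠ 0) :
    ∃ (v : Fin 3 → F) (B : Finset F), B.card + weight c = Fintype.card F ∧
      (∀ d, S.Good (S.lift c d) ↔ v ⬝ᵥ d ∈ B) ∧ (v = 1 ∨ ∃ i, v = Pi.single i 1) := by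
  classical
  have hq : 2 ≤ Fintype.card F := Fintype.one_lt_card
  by_cases hne : ∀ i, c i ≠ 0
  · by_cases hs : c 0 + c 1 + c 2 = 0
    · obtain ⟨B, hB, h⟩ := S.exists_good_diagonal hne hs
      refine ⟨1, B, ?_, h, Or.inl rfl⟩
      simp only [weight_eq, hs, hne, if_true, if_false]
      omega
    · refine ⟨1, Finset.univ, ?_, fun d => iff_of_true (S.good_of_generic hne hs d) (by simp),
        Or.inl rfl⟩
      simp [weight_eq, hs, hne]
  · push Not at hne
    have hvertex : ∀ i, c i = 0 → c (i + 1) = 0 → c (i + 2) ≠ 0 →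
        ∃ (v : Fin 3 → F) (B : Finset F), B.card + weight c = Fintype.card F ∧
          (∀ d, S.Good (S.lift c d) ↔ v ⬝ᵥ d ∈ B) ∧ (v = 1 ∨ ∃ i, v = Pi.single i 1) := by
      intro i h0 h1 h2
      obtain ⟨B, hB, h⟩ := S.exists_good_vertex i h0 h1 h2
      refine ⟨Pi.single i 1, B, ?_, by simpa using h, Or.inr ⟨i, rfl⟩⟩
      rw [← hB]
      fin_cases i <;> simp_all [weight_eq]
    obtain ⟨i, h0⟩ := hne
    by_cases h1 : c (i + 1) = 0
    · refine hvertex i h0 h1 fun h2 => hc ?_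
      ext j
      fin_cases i <;> fin_cases j <;> simp_all
    · by_cases h2 : c (i + 2) = 0
      -- In `Fin 3`, `(i + 2) + 1 = i`: the other vertex of the axis is governed by the coordinate
      -- `i + 2`.
      · refine hvertex (i + 2) h2 ?_ ?_ <;> fin_cases i <;> simp_all
      · by_cases hs : c (i + 1) + c (i + 2) = 0
        · obtain ⟨B, hB, h⟩ := S.exists_good_crossing i h0 h1 h2 hs
          refine ⟨Pi.single i 1, B, ?_, by simpa using h, Or.inr ⟨i, rfl⟩⟩
          have hw : weight c = 1 + (Fintype.card F - 2) := by
            fin_cases i <;> simp_all [weight_eq, add_comm]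
          omega
        · obtain ⟨B, hB, h⟩ := S.exists_good_edge i h0 h1 h2 hs
          refine ⟨Pi.single i 1, B, ?_, by simpa using h, Or.inr ⟨i, rfl⟩⟩
          rw [← hB]
          fin_cases i <;> simp_all [weight_eq, add_comm]

variable [Fintype F]

open scoped Classical in
theorem sum_ite_dot_eq {u v : Fin 3 → F} (h : LinearIndependent F ![u, v]) (k : ℕ) :
    (∑ c with c ≠ 0 ∧ u ⬝ᵥ c = 0, if v ⬝ᵥ c = 0 then k else 0) =
      (Fintype.card F - 1) * k := by
  rw [← Finset.sum_filter, Finset.filter_filter, Finset.sum_const, smul_eq_mul,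
    ← card_ne_zero_dot_pair h, Nat.add_sub_cancel]
  simp only [and_assoc]

open scoped Classical in
theorem sum_ite_ne_zero {v : Fin 3 → F} (hv : v ≠ 0) (k : ℕ) :
    (∑ c with c ≠ 0, if v ⬝ᵥ c = 0 then k else 0) = (Fintype.card F ^ 2 - 1) * k := by
  rw [← Finset.sum_filter, Finset.filter_filter, Finset.sum_const, smul_eq_mul,
    ← card_ne_zero_dot hv, Nat.add_sub_cancel]

open scoped Classical in
/-- The number of vectors of residue `c` on the line `u` that generate points of the arc. -/
noncomputable def fiberCard (u : Fin 3 → R) (c : Fin 3 → F) : ℕ :=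
  (Finset.univ.filter fun d => u ⬝ᵥ S.lift c d = 0 ∧ S.Good (S.lift c d)).card

variable {S} {u : Fin 3 → R} {c : Fin 3 → F}

theorem fiberCard_eq {v : Fin 3 → F} {B : Finset F} (huc : S.residue u ⬝ᵥ c = 0)
    (hB : ∀ d, S.Good (S.lift c d) ↔ v ⬝ᵥ d ∈ B)
    (h : LinearIndependent F ![S.residue u, v]) :
    S.fiberCard u c = Fintype.card F * B.card := by
  classical
  obtain ⟨a, ha⟩ := S.exists_dotProduct_lift_eq_zero_iff u huc
  rw [fiberCard, ← card_dot_pair_mem h a B]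
  simp only [ha, hB]

theorem fiberCard_le (hu : S.residue u ≠ 0) (huc : S.residue u ⬝ᵥ c = 0) :
    S.fiberCard u c ≤ Fintype.card F ^ 2 := by
  classical
  obtain ⟨a, ha⟩ := S.exists_dotProduct_lift_eq_zero_iff u huc
  rw [fiberCard, ← card_dot hu a]
  refine Finset.card_le_card fun d hd => ?_
  simp only [Finset.mem_filter, Finset.mem_univ, true_and, ha] at hd ⊢
  exact hd.1

theorem fiberCard_add_weight (hc : c ≠ 0) (huc : S.residue u ⬝ᵥ c = 0)
    (h1 : LinearIndependent F ![S.residue u, 1])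
    (hs : ∀ i, LinearIndependent F ![S.residue u, Pi.single i 1]) :
    S.fiberCard u c + Fintype.card F * weight c = Fintype.card F ^ 2 := by
  obtain ⟨v, B, hB, hgood, hv⟩ := S.exists_form hc
  rw [fiberCard_eq huc hgood (by rcases hv with rfl | ⟨i, rfl⟩; exacts [h1, hs i]), ← mul_add, hB,
    sq]

theorem fiberCard_vertex (i : Fin 3) (h0 : c i = 0) (h1 : c (i + 1) = 0) (h2 : c (i + 2) ≠ 0)
    (huc : S.residue u ⬝ᵥ c = 0) (h : LinearIndependent F ![S.residue u, Pi.single i 1]) :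
    S.fiberCard u c + 2 * Fintype.card F = Fintype.card F ^ 2 := by
  classical
  obtain ⟨B, hB, hgood⟩ := S.exists_good_vertex i h0 h1 h2
  rw [fiberCard_eq (v := Pi.single i 1) huc (by simpa using hgood) h, sq]
  nth_rw 3 [← hB]
  ring

theorem fiberCard_crossing (i : Fin 3) (h0 : c i = 0) (h1 : c (i + 1) ≠ 0) (h2 : c (i + 2) ≠ 0)
    (hs : c (i + 1) + c (i + 2) = 0) (huc : S.residue u ⬝ᵥ c = 0)
    (h : LinearIndependent F ![S.residue u, Pi.single i 1]) :
    S.fiberCard u c = Fintype.card F := by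
  classical
  obtain ⟨B, hB, hgood⟩ := S.exists_good_crossing i h0 h1 h2 hs
  rw [fiberCard_eq (v := Pi.single i 1) huc (by simpa using hgood) h, hB, mul_one]

end ResidueSystem

/-! ### Vectors of the arc on a whole line, and in total. -/

namespace ResidueSystem

open FieldCount

variable {R F : Type*} [Ring R] [Field F] (S : ResidueSystem R F)

/-- Right multiplication parametrizes the radical by any of its nonzero elements. -/
theorem exists_mul_eq [Finite F] {n m : R} (hn : S.π n = 0) (hn0 : n ≠ 0) (hm : S.π m = 0) :
    ∃ r, n * r = m := by
  have hex : ∀ c, ∃ b, S.τ b = n * S.s c := fun c =>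
    S.exists_τ _ (by rw [map_mul, hn, zero_mul])
  choose f hf using hex
  -- A collision would make a unit annihilate `n`; surjectivity then follows from finiteness of `F`.
  have hinj : Function.Injective f := by
    intro c c' h
    have h' : n * (S.s c - S.s c') = 0 := by rw [mul_sub, ← hf, ← hf, h, sub_self]
    by_contra hne
    obtain ⟨v, hv⟩ := S.isUnit (S.s c - S.s c') (by
      rwa [map_sub, S.π_s, S.π_s, sub_ne_zero])
    rw [← hv, Units.mul_left_eq_zero] at h'
    exact hn0 h'
  obtain ⟨b, hb⟩ := S.exists_τ m hm
  obtain ⟨c, hc⟩ := Finite.surjective_of_injective hinj b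
  exact ⟨S.s c, by rw [← hf, hc, hb]⟩

theorem mul_eq_mul_of_residue {n : R} (hn : S.π n = 0) {x y : R} (h : S.π x = S.π y) :
    n * x = n * y := by
  obtain ⟨d, rfl⟩ := S.exists_τ n hn
  obtain ⟨e, he⟩ := S.exists_τ (x - y) (by rw [map_sub, h, sub_self])
  rw [← sub_eq_zero, ← mul_sub, ← he, S.τ_mul_τ]

/-- Every line over `xᵢ = 0` misses the arc in some class of points. -/
theorem exists_not_good [Finite F] (i : Fin 3) {u : Fin 3 → R} (hi : S.residue u i ≠ 0)
    (h1 : S.residue u (i + 1) = 0) (h2 : S.residue u (i + 2) = 0) :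
    ∃ s : F, ∀ x, S.residue x i = 0 → S.residue x (i + 1) = s * S.residue x (i + 2) →
      u ⬝ᵥ x = 0 → ¬ S.Good x := by
  obtain ⟨w, hw⟩ := S.isUnit (u i) hi
  obtain ⟨n1, hn1⟩ : ∃ n, n = ↑w⁻¹ * u (i + 1) := ⟨_, rfl⟩
  obtain ⟨n2, hn2⟩ : ∃ n, n = ↑w⁻¹ * u (i + 2) := ⟨_, rfl⟩
  have hπ1 : S.π n1 = 0 := by rw [hn1, map_mul]; exact mul_eq_zero_of_right _ h1
  have hπ2 : S.π n2 = 0 := by rw [hn2, map_mul]; exact mul_eq_zero_of_right _ h2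
  have hx : ∀ x, u ⬝ᵥ x = 0 → x i + n1 * x (i + 1) + n2 * x (i + 2) = 0 := by
    intro x h
    have hsum : u ⬝ᵥ x = u i * x i + u (i + 1) * x (i + 1) + u (i + 2) * x (i + 2) := by
      rw [dotProduct, Fin.sum_univ_three]
      fin_cases i <;> simp <;> abel
    have := congrArg (fun t : R => ↑w⁻¹ * t) (hsum.symm.trans h)
    simpa only [mul_add, ← mul_assoc, ← hw, Units.inv_mul, one_mul, mul_zero, ← hn1, ← hn2]
      using this
  have hx2 : ∀ x s, S.Good x → S.residue x i = 0 →
      S.residue x (i + 1) = s * S.residue x (i + 2) → S.residue x (i + 2) ≠ 0 := by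
    intro x s hg h0 hxs h
    rw [h, mul_zero] at hxs
    refine hg.1 (funext fun j => ?_)
    fin_cases i <;> fin_cases j <;> simp_all
  -- The line is `x i = -(n1 * x (i + 1) + n2 * x (i + 2))`. If `n1 = 0`, then `-n2 = θ` gives the
  -- second value forbidden at the vertex `s = 0`, while any other `n2` misses the only value
  -- allowed at the crossing `s = -1`.
  by_cases hn0 : n1 = 0
  · by_cases hθ : -n2 = S.θ
    · refine ⟨0, fun x h0 hxs hux hg => ?_⟩
      rw [zero_mul] at hxs
      refine (hg.2.1 i h0 hxs).2 ?_
      have := hx x hux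
      rw [hn0, zero_mul, add_zero] at this
      rw [← hθ, neg_mul, eq_neg_of_add_eq_zero_left this]
    · refine ⟨-1, fun x h0 hxs hux hg => hθ ?_⟩
      have hne := hx2 x _ hg h0 hxs
      have hcross := hg.2.2.2.1 i h0 (by rw [hxs]; simpa using hne) hne (by rw [hxs]; ring)
      have := hx x hux
      rw [hn0, zero_mul, add_zero] at this
      obtain ⟨v, hv⟩ := S.isUnit _ hne
      rw [eq_neg_of_add_eq_zero_left this, ← hv, ← neg_mul] at hcross
      exact v.mul_left_inj.1 hcross
  -- Over the class with ratio `r` the two radical terms cancel, so `x i = 0`, a value forbidden in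
  -- every class of the axis.
  · obtain ⟨r, hr⟩ := S.exists_mul_eq hπ1 hn0 (m := -n2) (by rw [map_neg, hπ2, neg_zero])
    refine ⟨S.π r, fun x h0 hxs hux hg => ?_⟩
    have hne := hx2 x _ hg h0 hxs
    have hxi : x i = 0 := by
      have := hx x hux
      rwa [S.mul_eq_mul_of_residue hπ1 (y := r * x (i + 2)) (by rw [map_mul]; exact hxs),
        ← mul_assoc, hr, neg_mul, neg_add_cancel_right] at this
    by_cases hx1 : S.residue x (i + 1) = 0
    · exact (hg.2.1 i h0 hx1).1 hxi
    · by_cases hs : S.residue x (i + 1) + S.residue x (i + 2) = 0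
      · have := hg.2.2.2.1 i h0 hx1 hne hs
        rw [hxi, eq_comm, S.θ_mul_eq_zero] at this
        exact hne this
      · exact hg.2.2.1 i h0 hx1 hne hs hxi

variable [Fintype F]

open scoped Classical in
theorem card_filter_eq_sum [Fintype R] (p : (Fin 3 → R) → Prop) [DecidablePred p] :
    (Finset.univ.filter p).card =
      ∑ c : Fin 3 → F, (Finset.univ.filter fun d => p (S.lift c d)).card := by
  simp only [Finset.card_filter]
  rw [← S.lift_bijective.sum_comp, Fintype.sum_prod_type]

open scoped Classical in
/-- The number of vectors on the line `u` that generate points of the arc. -/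
noncomputable def lineCard [Fintype R] (u : Fin 3 → R) : ℕ :=
  (Finset.univ.filter fun x => u ⬝ᵥ x = 0 ∧ S.Good x).card

open scoped Classical in
theorem lineCard_eq_sum [Fintype R] (u : Fin 3 → R) :
    S.lineCard u = ∑ c with c ≠ 0 ∧ S.residue u ⬝ᵥ c = 0, S.fiberCard u c := by
  rw [lineCard, S.card_filter_eq_sum]
  symm
  refine Finset.sum_subset (Finset.subset_univ _) fun c _ hc => ?_
  rw [fiberCard, Finset.card_eq_zero, Finset.filter_eq_empty_iff]
  rintro d - ⟨h1, h2⟩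
  refine hc (Finset.mem_filter.2 ⟨Finset.mem_univ _, ?_, ?_⟩)
  · simpa only [S.residue_lift] using h2.1
  · rw [← S.residue_lift c d, ← S.π_dotProduct, h1, map_zero]

-- Each of the four forms vanishes on `q - 1` nonzero vectors of the residue line, and `3 + (q - 2)
-- = q + 1`.
open scoped Classical in
theorem sum_weight {u : Fin 3 → F} (h1 : LinearIndependent F ![u, 1])
    (hs : ∀ i, LinearIndependent F ![u, Pi.single i 1]) :
    (∑ c with c ≠ 0 ∧ u ⬝ᵥ c = 0, weight c) = Fintype.card F ^ 2 - 1 := by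
  simp only [weight]
  rw [Finset.sum_add_distrib, Finset.sum_comm, sum_ite_dot_eq h1,
    Finset.sum_congr rfl fun i _ => sum_ite_dot_eq (hs i) 1]
  obtain ⟨k, hk⟩ := Nat.exists_eq_add_of_le' (Fintype.one_lt_card (α := F) : 2 ≤ _)
  simp only [hk, Finset.sum_const, Finset.card_univ, Fintype.card_fin, smul_eq_mul]
  rw [show k + 2 - 1 = k + 1 from rfl, show k + 2 - 2 = k from rfl]
  symm
  exact Nat.sub_eq_of_eq_add (by ring)

theorem lineCard_le_of_generic [Fintype R] {u : Fin 3 → R}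
    (h1 : LinearIndependent F ![S.residue u, 1])
    (hs : ∀ i, LinearIndependent F ![S.residue u, Pi.single i 1]) :
    S.lineCard u ≤ (Fintype.card F ^ 2 - 1) * (Fintype.card F ^ 2 - Fintype.card F) := by
  classical
  have hu : S.residue u ≠ 0 := h1.ne_zero 0
  have hsum : S.lineCard u + Fintype.card F * (Fintype.card F ^ 2 - 1) =
      (Fintype.card F ^ 2 - 1) * Fintype.card F ^ 2 := by
    rw [lineCard_eq_sum, ← sum_weight h1 hs, Finset.mul_sum, ← Finset.sum_add_distrib,
      Finset.sum_congr rfl fun c hc => fiberCard_add_weight (Finset.mem_filter.1 hc).2.1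
        (Finset.mem_filter.1 hc).2.2 h1 hs, Finset.sum_const, smul_eq_mul, sum_weight h1 hs,
      ← card_ne_zero_dot hu, Nat.add_sub_cancel]
  rw [Nat.mul_sub, ← hsum, mul_comm (Fintype.card F), Nat.add_sub_cancel]

/-- In the three crossing classes only `q` of `q²` vectors survive for each `c`. The loss `3(q -
1)(q² - q)` is at least the required `(q + 1)(q² - q)` because `q ≥ 2`. -/
theorem lineCard_le_of_diagonal [Fintype R] {u : Fin 3 → R} (hu : S.residue u ≠ 0)
    (hdiag : ∀ c, S.residue u ⬝ᵥ c = 0 ↔ c 0 + c 1 + c 2 = 0)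
    (hs : ∀ i, LinearIndependent F ![S.residue u, Pi.single i 1]) :
    S.lineCard u ≤ (Fintype.card F ^ 2 - 1) * (Fintype.card F ^ 2 - Fintype.card F) := by
  classical
  -- With `q = k + 2` the natural number subtractions become polynomials in `k`; `k ^ 2 + 3 * k + 2`
  -- is `q² - q`.
  obtain ⟨k, hk⟩ := Nat.exists_eq_add_of_le' (Fintype.one_lt_card (α := F) : 2 ≤ _)
  have hq : Fintype.card F ^ 2 - Fintype.card F = k ^ 2 + 3 * k + 2 :=
    Nat.sub_eq_of_eq_add (by rw [hk]; ring)
  have hq1 : Fintype.card F ^ 2 - 1 = k ^ 2 + 4 * k + 3 :=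
    Nat.sub_eq_of_eq_add (by rw [hk]; ring)
  have hA := card_ne_zero_dot hu
  have hle : ∀ c ∈ Finset.univ.filter fun c => c ≠ 0 ∧ S.residue u ⬝ᵥ c = 0,
      S.fiberCard u c + ∑ i : Fin 3, (if (Pi.single i 1 : Fin 3 → F) ⬝ᵥ c = 0 then
        k ^ 2 + 3 * k + 2 else 0) ≤ Fintype.card F ^ 2 := by
    intro c hc
    obtain ⟨hc0, huc⟩ := (Finset.mem_filter.1 hc).2
    have hsum := (hdiag c).1 huc
    simp only [single_dotProduct, one_mul]
    by_cases hne : ∀ i, c i ≠ 0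
    · simpa [hne] using fiberCard_le hu huc
    · push Not at hne
      obtain ⟨i, hi⟩ := hne
      have hsum' : c (i + 1) + c (i + 2) = 0 := by
        fin_cases i <;> simp_all [add_comm]
      have h1 : c (i + 1) ≠ 0 := fun h1 => hc0 (by
        ext j
        rw [h1, zero_add] at hsum'
        fin_cases i <;> fin_cases j <;> simp_all)
      have h2 : c (i + 2) ≠ 0 := fun h2 => h1 (by simpa [h2] using hsum')
      have hval : (∑ j : Fin 3, if c j = 0 then k ^ 2 + 3 * k + 2 else 0) =
          k ^ 2 + 3 * k + 2 := by
        rw [Fin.sum_univ_three]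
        fin_cases i <;> simp_all
      rw [fiberCard_crossing i hi h1 h2 hsum' huc (hs i), hval, hk]
      exact le_of_eq (by ring)
  have h := Finset.sum_le_sum hle
  rw [Finset.sum_add_distrib, ← lineCard_eq_sum, Finset.sum_comm,
    Finset.sum_congr rfl fun i _ => sum_ite_dot_eq (hs i) _, Finset.sum_const, Finset.sum_const,
    smul_eq_mul, smul_eq_mul, Finset.card_univ, Fintype.card_fin, hk,
    show k + 2 - 1 = k + 1 from rfl] at h
  rw [hk] at hA
  rw [hq, hq1]
  have hA' : (Finset.univ.filter fun c => c ≠ 0 ∧ S.residue u ⬝ᵥ c = 0).card =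
    k ^ 2 + 4 * k + 3 := by linarith
  rw [hA'] at h
  nlinarith [h, Nat.zero_le k, sq_nonneg k, pow_nonneg (Nat.zero_le k) 3]

end ResidueSystem

namespace ResidueSystem

open FieldCount

variable {R F : Type*} [Ring R] [Field F] [Fintype F] (S : ResidueSystem R F)

/-- The forms `v` and `w` pick out the vertex whose removed segments cross the line (loss `2q` for
each `c`) and the class lost entirely (loss `q²`). Together they give `(q - 1)(q² + 2q)`, more than
the required `(q - 1)(q² + q)`. -/
theorem lineCard_le_of_axis [Fintype R] (i : Fin 3) {u : Fin 3 → R} (hi : S.residue u i ≠ 0)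
    (h1 : S.residue u (i + 1) = 0) (h2 : S.residue u (i + 2) = 0) :
    S.lineCard u ≤ (Fintype.card F ^ 2 - 1) * (Fintype.card F ^ 2 - Fintype.card F) := by
  classical
  have hu : S.residue u ≠ 0 := fun h => hi (congrFun h i)
  have hdot : ∀ c, S.residue u ⬝ᵥ c = 0 ↔ c i = 0 := by
    intro c
    have : S.residue u ⬝ᵥ c = S.residue u i * c i := by
      rw [dotProduct, Fin.sum_univ_three]
      fin_cases i <;> simp_all
    rw [this, mul_eq_zero, or_iff_right hi]
  obtain ⟨s, hs⟩ := S.exists_not_good i hi h1 h2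
  let v : Fin 3 → F := Pi.single (i + 2) 1
  let w : Fin 3 → F := Pi.single (i + 1) 1 - Pi.single (i + 2) s
  have hv : LinearIndependent F ![S.residue u, v] := by
    rw [LinearIndependent.pair_iff' hu]
    intro a h
    have := congrFun h (i + 2)
    simp [v, h2] at this
  have hw : LinearIndependent F ![S.residue u, w] := by
    rw [LinearIndependent.pair_iff' hu]
    intro a h
    have := congrFun h (i + 1)
    simp [w, h1] at this
  obtain ⟨k, hk⟩ := Nat.exists_eq_add_of_le' (Fintype.one_lt_card (α := F) : 2 ≤ _)
  have hq : Fintype.card F ^ 2 - Fintype.card F = k ^ 2 + 3 * k + 2 :=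
    Nat.sub_eq_of_eq_add (by rw [hk]; ring)
  have hq1 : Fintype.card F ^ 2 - 1 = k ^ 2 + 4 * k + 3 :=
    Nat.sub_eq_of_eq_add (by rw [hk]; ring)
  have hA := card_ne_zero_dot hu
  have hle : ∀ c ∈ Finset.univ.filter fun c => c ≠ 0 ∧ S.residue u ⬝ᵥ c = 0,
      S.fiberCard u c + ((if v ⬝ᵥ c = 0 then 2 * Fintype.card F else 0) +
        if w ⬝ᵥ c = 0 then Fintype.card F ^ 2 else 0) ≤ Fintype.card F ^ 2 := by
    intro c hc
    obtain ⟨hc0, huc⟩ := (Finset.mem_filter.1 hc).2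
    have hci := (hdot c).1 huc
    have hvc : v ⬝ᵥ c = c (i + 2) := by simp [v]
    have hwc : w ⬝ᵥ c = c (i + 1) - s * c (i + 2) := by simp [w, sub_dotProduct]
    have hnot : c (i + 1) = 0 → c (i + 2) ≠ 0 := fun h1 h2 => hc0 (by
      ext j
      fin_cases i <;> fin_cases j <;> simp_all)
    rw [hvc, hwc]
    by_cases hc2 : c (i + 2) = 0
    · have hc1 : c (i + 1) ≠ 0 := fun h => hnot h hc2
      have hLI : LinearIndependent F ![S.residue u, Pi.single (i + 2) 1] := hv
      have h := fiberCard_vertex (S := S) (u := u) (c := c) (i + 2) hc2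
        (by fin_cases i <;> simpa using hci) (by fin_cases i <;> simpa using hc1) huc hLI
      rw [if_pos hc2, hc2, mul_zero, sub_zero, if_neg hc1, add_zero, h]
    · rw [if_neg hc2, zero_add]
      split_ifs with hc1
      · have h : S.fiberCard u c = 0 := by
          rw [fiberCard, Finset.card_eq_zero, Finset.filter_eq_empty_iff]
          rintro d - ⟨hd, hg⟩
          refine hs _ ?_ ?_ hd hg <;> rw [S.residue_lift]
          exacts [hci, sub_eq_zero.1 hc1]
        rw [h, zero_add]
      · simpa using fiberCard_le hu huc
  have h := Finset.sum_le_sum hle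
  rw [Finset.sum_add_distrib, ← lineCard_eq_sum, Finset.sum_add_distrib, sum_ite_dot_eq hv,
    sum_ite_dot_eq hw, Finset.sum_const, smul_eq_mul, hk,
    show k + 2 - 1 = k + 1 from rfl] at h
  rw [hk] at hA
  rw [hq, hq1]
  have hA' : (Finset.univ.filter fun c => c ≠ 0 ∧ S.residue u ⬝ᵥ c = 0).card =
    k ^ 2 + 4 * k + 3 := by linarith
  rw [hA'] at h
  nlinarith [h, Nat.zero_le k, sq_nonneg k, pow_nonneg (Nat.zero_le k) 3]

/-- Every line has at most `q ^ 2 - 1` points in the arc, counted by their generators. -/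
theorem lineCard_le [Fintype R] {u : Fin 3 → R} (hu : S.residue u ≠ 0) :
    S.lineCard u ≤ (Fintype.card F ^ 2 - 1) * (Fintype.card F ^ 2 - Fintype.card F) := by
  classical
  by_cases hs : ∀ i, LinearIndependent F ![S.residue u, Pi.single i 1]
  · by_cases h1 : LinearIndependent F ![S.residue u, 1]
    · exact S.lineCard_le_of_generic h1 hs
    · rw [LinearIndependent.pair_iff' hu] at h1
      push Not at h1
      obtain ⟨a, ha⟩ := h1
      refine S.lineCard_le_of_diagonal hu (fun c => ?_) hs
      have ha0 : a ≠ 0 := by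
        rintro rfl
        exact zero_ne_one (congrFun ((zero_smul F _).symm.trans ha) 0)
      rw [← mul_right_inj' ha0, mul_zero, ← smul_eq_mul, ← smul_dotProduct, ha, one_dotProduct,
        Fin.sum_univ_three]
  · push Not at hs
    obtain ⟨i, hi⟩ := hs
    rw [LinearIndependent.pair_iff' hu] at hi
    push Not at hi
    obtain ⟨a, ha⟩ := hi
    have hai : a * S.residue u i = 1 := by simpa using congrFun ha i
    have ha0 : a ≠ 0 := left_ne_zero_of_mul_eq_one hai
    have hj : ∀ j, j ≠ i → S.residue u j = 0 := fun j hj => by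
      simpa [hj, ha0] using congrFun ha j
    exact S.lineCard_le_of_axis i (right_ne_zero_of_mul_eq_one hai)
      (hj _ (by fin_cases i <;> decide)) (hj _ (by fin_cases i <;> decide))

open scoped Classical in
theorem sum_weight_ne_zero :
    (∑ c : Fin 3 → F with c ≠ 0, weight c) =
      (Fintype.card F + 1) * (Fintype.card F ^ 2 - 1) := by
  have hone : (1 : Fin 3 → F) ≠ 0 := one_ne_zero
  have hsingle : ∀ i : Fin 3, (Pi.single i 1 : Fin 3 → F) ≠ 0 := fun i => by simp
  simp only [weight]
  rw [Finset.sum_add_distrib, Finset.sum_comm, sum_ite_ne_zero hone,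
    Finset.sum_congr rfl fun i _ => sum_ite_ne_zero (hsingle i) 1]
  obtain ⟨k, hk⟩ := Nat.exists_eq_add_of_le' (Fintype.one_lt_card (α := F) : 2 ≤ _)
  simp only [hk, Finset.sum_const, Finset.card_univ, Fintype.card_fin, smul_eq_mul]
  rw [show k + 2 - 2 = k from rfl]
  ring

-- Each nonzero `c` leaves `q³ - q² * weight c` good vectors; summing uses `sum_weight_ne_zero`.
open scoped Classical in
theorem card_good [Fintype R] :
    (Finset.univ.filter S.Good).card =
      (Fintype.card F ^ 4 - Fintype.card F ^ 2 - Fintype.card F) *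
        (Fintype.card F ^ 2 - Fintype.card F) := by
  have hsum : (Finset.univ.filter S.Good).card +
      Fintype.card F ^ 2 * ((Fintype.card F + 1) * (Fintype.card F ^ 2 - 1)) =
      (Fintype.card F ^ 3 - 1) * Fintype.card F ^ 3 := by
    have hsub : ∑ c : Fin 3 → F, (Finset.univ.filter fun d => S.Good (S.lift c d)).card =
        ∑ c with c ≠ 0, (Finset.univ.filter fun d => S.Good (S.lift c d)).card := by
      symm
      refine Finset.sum_subset (Finset.subset_univ _) fun c _ hc => ?_
      rw [Finset.card_eq_zero, Finset.filter_eq_empty_iff]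
      rintro d - hg
      refine hc (Finset.mem_filter.2 ⟨Finset.mem_univ _, ?_⟩)
      simpa only [S.residue_lift] using hg.1
    rw [S.card_filter_eq_sum, hsub, ← sum_weight_ne_zero, Finset.mul_sum,
      ← Finset.sum_add_distrib, Finset.sum_congr rfl fun c hc => ?_, Finset.sum_const, smul_eq_mul,
      Finset.filter_ne', Finset.card_erase_of_mem (Finset.mem_univ _), Finset.card_univ,
      Fintype.card_fun, Fintype.card_fin]
    obtain ⟨v, B, hB, hgood, hv⟩ := S.exists_form (Finset.mem_filter.1 hc).2
    have hv0 : v ≠ 0 := by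
      rcases hv with rfl | ⟨i, rfl⟩
      · exact one_ne_zero
      · simp
    simp only [hgood]
    rw [card_dot_mem hv0, ← mul_add, hB, ← pow_succ]
  obtain ⟨k, hk⟩ := Nat.exists_eq_add_of_le' (Fintype.one_lt_card (α := F) : 2 ≤ _)
  have hq : Fintype.card F ^ 2 - Fintype.card F = k ^ 2 + 3 * k + 2 :=
    Nat.sub_eq_of_eq_add (by rw [hk]; ring)
  have hq1 : Fintype.card F ^ 2 - 1 = k ^ 2 + 4 * k + 3 :=
    Nat.sub_eq_of_eq_add (by rw [hk]; ring)
  have hq3 : Fintype.card F ^ 3 - 1 = k ^ 3 + 6 * k ^ 2 + 12 * k + 7 :=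
    Nat.sub_eq_of_eq_add (by rw [hk]; ring)
  have hq4 : Fintype.card F ^ 4 - Fintype.card F ^ 2 - Fintype.card F =
      k ^ 4 + 8 * k ^ 3 + 23 * k ^ 2 + 27 * k + 10 := by
    rw [Nat.sub_sub]
    exact Nat.sub_eq_of_eq_add (by rw [hk]; ring)
  rw [hq1, hq3, hk] at hsum
  rw [hq4, hq]
  nlinarith [hsum]

end ResidueSystem

/-! ### From vectors to points and lines of the plane. -/

namespace ResidueSystem

open PHG MulOpposite

variable {R F : Type*} [Ring R] [Field F] (S : ResidueSystem R F)

theorem residue_smul (x : Fin 3 → R) (r : R) (i : Fin 3) :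
    S.residue (op r • x) i = S.residue x i * S.π r := by
  simp [residue]

/-- In `Good`, `θ` multiplies coordinates on the left, so its equations survive right multiplication
by a unit even when `R` is not commutative. -/
theorem good_smul {x : Fin 3 → R} (h : S.Good x) {r : R} (hr : S.π r ≠ 0) :
    S.Good (op r • x) := by
  obtain ⟨v, rfl⟩ := S.isUnit r hr
  obtain ⟨h0, h1, h2, h3, h4⟩ := h
  have hne : ∀ i, S.residue (op (v : R) • x) i = 0 ↔ S.residue x i = 0 := fun i => by
    rw [residue_smul, mul_eq_zero, or_iff_left hr]
  have hadd : ∀ i j, S.residue (op (v : R) • x) i + S.residue (op (v : R) • x) j = 0 ↔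
      S.residue x i + S.residue x j = 0 := fun i j => by
    rw [residue_smul, residue_smul, ← add_mul, mul_eq_zero, or_iff_left hr]
  have hadd3 : S.residue (op (v : R) • x) 0 + S.residue (op (v : R) • x) 1 +
      S.residue (op (v : R) • x) 2 = 0 ↔
      S.residue x 0 + S.residue x 1 + S.residue x 2 = 0 := by
    rw [residue_smul, residue_smul, residue_smul, ← add_mul, ← add_mul, mul_eq_zero,
      or_iff_left hr]
  refine ⟨fun h => h0 (funext fun i => (hne i).1 (congrFun h i)), fun i => ?_, fun i => ?_,
    fun i => ?_, ?_⟩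
  · rw [hne, hne]
    simpa [← mul_assoc] using h1 i
  · rw [hne, ne_eq, ne_eq, ne_eq, hne, hne, hadd]
    simpa using h2 i
  · rw [hne, ne_eq, ne_eq, hne, hne, hadd]
    simpa [← mul_assoc] using h3 i
  · simp only [ne_eq, hne, hadd3]
    simpa [← mul_assoc, ← add_mul] using h4

theorem mul_θ_eq_zero {r : R} : r * S.θ = 0 ↔ S.π r = 0 := by
  rw [θ, S.mul_τ, mul_one, S.τ_eq_zero]

theorem smul_θ_eq_zero {x : Fin 3 → R} (h : S.residue x = 0) : op S.θ • x = 0 :=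
  funext fun i => S.mul_θ_eq_zero.2 (congrFun h i)

theorem isFreeOfRank_span {x : Fin 3 → R} (h : S.residue x ≠ 0) :
    IsFreeOfRank 1 (Submodule.span Rᵐᵒᵖ {x}) := by
  obtain ⟨i, hi⟩ := Function.ne_iff.1 h
  have hli : LinearIndependent Rᵐᵒᵖ fun _ : Fin 1 => x := by
    rw [Fintype.linearIndependent_iff]
    intro g hg j
    rw [Fin.sum_univ_one] at hg
    obtain ⟨v, hv⟩ := S.isUnit (x i) hi
    have := congrFun hg i
    rw [Pi.smul_apply, smul_eq_mul_unop, ← hv, Pi.zero_apply, Units.mul_right_eq_zero] at this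
    rw [Subsingleton.elim j 0]
    exact unop_injective this
  have hb := Module.Basis.span hli
  rw [Set.range_const] at hb
  exact ⟨hb⟩

theorem exists_generator_of_isFreeOfRank {P : Submodule Rᵐᵒᵖ (Fin 3 → R)}
    (h : IsFreeOfRank 1 P) :
    ∃ x, Submodule.span Rᵐᵒᵖ {x} = P ∧ ∀ r : Rᵐᵒᵖ, r • x = 0 → r = 0 := by
  obtain ⟨b⟩ := h
  refine ⟨b 0, ?_, fun r hr => ?_⟩
  · have h := b.span_eq
    rw [Set.range_unique, Fin.default_eq_zero] at h
    have := congrArg (Submodule.map P.subtype) h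
    rwa [Submodule.map_span, Set.image_singleton, Submodule.map_top, Submodule.range_subtype]
      at this
  · have := Fintype.linearIndependent_iff.1 b.linearIndependent (fun _ => r)
      (by rw [Fin.sum_univ_one]; exact Subtype.ext hr)
    exact this 0

open scoped Classical in
theorem card_units [Fintype R] [Fintype F] :
    (Finset.univ.filter fun r => S.π r ≠ 0).card = Fintype.card F ^ 2 - Fintype.card F := by
  have hbij : Function.Bijective fun p : F × F => S.s p.1 + S.τ p.2 := by
    constructor
    · rintro ⟨c, d⟩ ⟨c', d'⟩ h
      have hc : c = c' := by simpa [S.π_s, S.π_τ] using congrArg S.π h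
      subst hc
      exact Prod.ext rfl (S.τ_injective (add_left_cancel h))
    · intro r
      obtain ⟨d, hd⟩ := S.exists_τ (r - S.s (S.π r)) (by rw [map_sub, S.π_s, sub_self])
      exact ⟨(S.π r, d), by simp [hd]⟩
  rw [Finset.card_filter, ← hbij.sum_comp, Fintype.sum_prod_type]
  simp only [map_add, S.π_s, S.π_τ, add_zero, Finset.sum_const, Finset.card_univ, smul_eq_mul]
  rw [← Finset.mul_sum, ← Finset.card_filter, Finset.filter_ne',
    Finset.card_erase_of_mem (Finset.mem_univ _), Finset.card_univ, Nat.mul_sub, sq, mul_one]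

open scoped Classical in
theorem card_generators (S : ResidueSystem R F) [Fintype R] [Fintype F] (P : Point R) :
    (Finset.univ.filter fun x => Submodule.span Rᵐᵒᵖ {x} = P.1).card =
      Fintype.card F ^ 2 - Fintype.card F := by
  obtain ⟨x, hx, hfree⟩ := exists_generator_of_isFreeOfRank P.2
  rw [← S.card_units, ← Finset.card_image_of_injective (f := fun r : R => op r • x)]
  · congr 1
    ext y
    simp only [Finset.mem_filter, Finset.mem_univ, true_and, Finset.mem_image]
    constructor
    · intro hy
      obtain ⟨a, ha⟩ := Submodule.mem_span_singleton.1
        (hx.trans hy.symm ▸ Submodule.mem_span_singleton_self y : y ∈ Submodule.span Rᵐᵒᵖ {x})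
      obtain ⟨b, hb⟩ := Submodule.mem_span_singleton.1
        (hy.trans hx.symm ▸ Submodule.mem_span_singleton_self x : x ∈ Submodule.span Rᵐᵒᵖ {y})
      refine ⟨unop a, fun h => ?_, ha⟩
      have hba : b * a - 1 = 0 := hfree _ (by rw [sub_smul, mul_smul, ha, hb, one_smul, sub_self])
      have := congrArg (fun t => S.π (unop t)) (sub_eq_zero.1 hba)
      simp [h] at this
    · rintro ⟨r, hr, rfl⟩
      rw [← hx]
      exact Submodule.span_singleton_smul_eq ((S.isUnit r hr).op) x
  · intro r r' h
    have := hfree (op r - op r') (by rw [sub_smul]; exact sub_eq_zero.2 h)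
    exact op_injective (sub_eq_zero.1 this)

/-- A vector with zero residue is killed by right multiplication by `θ`, which freeness rules out.
-/
theorem residue_ne_zero_of_free {x y : Fin 3 → R}
    (h : ∀ a b : Rᵐᵒᵖ, a • x + b • y = 0 → a = 0 ∧ b = 0) (r : R) :
    S.residue (y - op r • x) ≠ 0 := by
  intro h0
  have hz := S.smul_θ_eq_zero h0
  rw [smul_sub, ← mul_smul, sub_eq_add_neg, ← neg_smul, add_comm] at hz
  have hθ : S.θ = 0 := op_injective (h _ _ hz).2
  have := S.mul_θ_eq_zero.1 ((one_mul _).trans hθ)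
  rw [map_one] at this
  exact one_ne_zero this

theorem exists_dotProduct_eq_zero (S : ResidueSystem R F) {x y : Fin 3 → R}
    (h : ∀ a b : Rᵐᵒᵖ, a • x + b • y = 0 → a = 0 ∧ b = 0) :
    ∃ u, S.residue u ≠ 0 ∧ u ⬝ᵥ x = 0 ∧ u ⬝ᵥ y = 0 := by
  have hx : S.residue x ≠ 0 := by
    have := S.residue_ne_zero_of_free (x := y) (y := x)
      (fun a b hab => (h b a (by rwa [add_comm])).symm) 0
    simpa using this
  obtain ⟨i, hi⟩ := Function.ne_iff.1 hx
  obtain ⟨v, hv⟩ := S.isUnit (x i) hi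
  obtain ⟨z, hz⟩ : ∃ z, z = y - op (↑v⁻¹ * y i) • x := ⟨_, rfl⟩
  have hzi : z i = 0 := by simp [hz, ← hv]
  obtain ⟨j, hj⟩ := Function.ne_iff.1 (hz ▸ S.residue_ne_zero_of_free h ((↑v⁻¹ : R) * y i))
  obtain ⟨w, hw⟩ := S.isUnit (z j) hj
  have hij : i ≠ j := by
    rintro rfl
    exact hj (by simp [hzi, residue])
  obtain ⟨k, hki, hkj⟩ : ∃ k : Fin 3, k ≠ i ∧ k ≠ j := by
    clear * -
    revert i j
    decide
  -- Back substitution with the pivots `x i` and `z j`: the entry at `k` is 1, the entry at `j`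
  -- makes `u ⬝ᵥ z = 0`, and the entry at `i` makes `u ⬝ᵥ x = 0`.
  let u : Fin 3 → R := Pi.single k 1 - Pi.single j (z k * ↑w⁻¹) +
    Pi.single i ((z k * ↑w⁻¹ * x j - x k) * ↑v⁻¹)
  have hux : u ⬝ᵥ x = 0 := by
    simp only [u, add_dotProduct, sub_dotProduct, single_dotProduct, ← hv, one_mul,
      Units.inv_mul_cancel_right]
    abel
  have huz : u ⬝ᵥ z = 0 := by
    simp only [u, add_dotProduct, sub_dotProduct, single_dotProduct, hzi, ← hw, one_mul,
      Units.inv_mul_cancel_right, mul_zero, add_zero, sub_self]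
  refine ⟨u, fun h0 => ?_, hux, ?_⟩
  · have := congrFun h0 k
    simp [u, residue, hki, hkj] at this
  · have hy : y = z + op (↑v⁻¹ * y i) • x := by rw [hz, sub_add_cancel]
    rw [hy, dotProduct_add, dotProduct_smul, hux, huz, smul_zero, add_zero]

/-- Every line of the plane is contained in the kernel of a unimodular linear form. -/
theorem exists_form_of_line (L : Line R) :
    ∃ u, S.residue u ≠ 0 ∧ ∀ x ∈ L.1, u ⬝ᵥ x = 0 := by
  obtain ⟨b⟩ := L.2
  obtain ⟨u, hu, h0, h1⟩ := S.exists_dotProduct_eq_zero (x := b 0) (y := b 1) (by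
    intro r r' h
    have := Fintype.linearIndependent_iff.1 b.linearIndependent ![r, r']
      (by rw [Fin.sum_univ_two]; exact Subtype.ext h)
    exact ⟨this 0, this 1⟩)
  refine ⟨u, hu, fun x hx => ?_⟩
  have := congrArg Subtype.val (b.sum_repr ⟨x, hx⟩)
  rw [Fin.sum_univ_two] at this
  change _ • (b 0 : Fin 3 → R) + _ • (b 1 : Fin 3 → R) = x at this
  rw [← this, dotProduct_add, dotProduct_smul, dotProduct_smul, h0, h1, smul_zero, smul_zero,
    add_zero]

open scoped Classical in
/-- The arc, as the characteristic function of the set of points with a good generator. -/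
noncomputable def arc (P : Point R) : ℕ :=
  if ∃ x, Submodule.span Rᵐᵒᵖ {x} = P.1 ∧ S.Good x then 1 else 0

theorem good_of_span_eq {x y : Fin 3 → R} (hx : S.Good x)
    (h : Submodule.span Rᵐᵒᵖ {x} = Submodule.span Rᵐᵒᵖ {y}) : S.Good y := by
  obtain ⟨a, rfl⟩ := Submodule.mem_span_singleton.1
    (h ▸ Submodule.mem_span_singleton_self y : y ∈ Submodule.span Rᵐᵒᵖ {x})
  obtain ⟨b, hb⟩ := Submodule.mem_span_singleton.1
    (h ▸ Submodule.mem_span_singleton_self x : x ∈ Submodule.span Rᵐᵒᵖ {a • x})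
  refine S.good_smul hx (r := unop a) fun ha => hx.1 (funext fun i => ?_)
  rw [← hb, ← op_unop b, residue_smul, ← op_unop a, residue_smul, ha]
  simp

instance finite_point [Finite R] : Finite (Point R) :=
  have : Finite (Submodule Rᵐᵒᵖ (Fin 3 → R)) := Finite.of_injective _ SetLike.coe_injective
  Subtype.finite

-- Double counting: generator sets of distinct points are disjoint and have `q² - q` elements, and
-- one good generator makes all of them good.
open scoped Classical in
theorem pointCount_arc_mul [Fintype R] [Fintype F] (A : Set (Point R)) :
    pointCount S.arc A * (Fintype.card F ^ 2 - Fintype.card F) =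
      (Finset.univ.filter fun x => S.Good x ∧
        ∃ P ∈ A, Submodule.span Rᵐᵒᵖ {x} = P.1).card := by
  have : Fintype (Point R) := Fintype.ofFinite _
  have hcount : pointCount S.arc A = ((Set.toFinite A).toFinset.filter fun P =>
      ∃ x, Submodule.span Rᵐᵒᵖ {x} = P.1 ∧ S.Good x).card := by
    rw [pointCount, finsum_mem_eq_finite_toFinset_sum _ (Set.toFinite A), Finset.card_filter]
    exact Finset.sum_congr rfl fun P _ => by unfold arc; congr
  rw [hcount, ← smul_eq_mul, ← Finset.sum_const,
    ← Finset.sum_congr rfl fun P _ => S.card_generators P, ← Finset.card_biUnion]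
  · congr 1
    ext x
    simp only [Finset.mem_biUnion, Finset.mem_filter, Set.Finite.mem_toFinset, Finset.mem_univ,
      true_and]
    constructor
    · rintro ⟨P, ⟨hP, y, hy, hg⟩, hx⟩
      exact ⟨S.good_of_span_eq hg (hy.trans hx.symm), P, hP, hx⟩
    · rintro ⟨hg, P, hP, hx⟩
      exact ⟨P, ⟨hP, x, hx, hg⟩, hx⟩
  · intro P _ Q _ hne
    refine Finset.disjoint_left.2 fun x hx hx' => ?_
    simp only [Finset.mem_filter, Finset.mem_univ, true_and] at hx hx'
    exact hne (Subtype.ext (hx.symm.trans hx'))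

theorem isArc_arc [Finite R] [Fintype F] :
    IsArc S.arc (Fintype.card F ^ 4 - Fintype.card F ^ 2 - Fintype.card F)
      (Fintype.card F ^ 2 - 1) := by
  classical
  have : Fintype R := Fintype.ofFinite R
  have hpos : 0 < Fintype.card F ^ 2 - Fintype.card F := by
    have hq : 1 < Fintype.card F := Fintype.one_lt_card
    rw [Nat.sub_pos_iff_lt, sq]
    exact lt_mul_self hq
  constructor
  · apply Nat.eq_of_mul_eq_mul_right hpos
    rw [S.pointCount_arc_mul, ← S.card_good]
    congr 1
    ext x
    simp only [Finset.mem_filter, Finset.mem_univ, true_and, Set.mem_univ]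
    exact ⟨fun h => h.1, fun h => ⟨h, ⟨_, S.isFreeOfRank_span h.1⟩, rfl⟩⟩
  · intro L
    apply Nat.le_of_mul_le_mul_right _ hpos
    obtain ⟨u, hu, hL⟩ := S.exists_form_of_line L
    rw [S.pointCount_arc_mul]
    refine le_trans (Finset.card_le_card fun x hx => ?_) (S.lineCard_le hu)
    simp only [Finset.mem_filter, Finset.mem_univ, true_and] at hx ⊢
    obtain ⟨hg, P, hP, hx⟩ := hx
    have hxP : x ∈ P.1 := hx ▸ Submodule.mem_span_singleton_self x
    exact ⟨hL x (hP hxP), hg⟩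

theorem isProjective_arc : IsProjective S.arc := fun P => by
  unfold arc
  split_ifs
  exacts [Or.inr rfl, Or.inl rfl]

end ResidueSystem

namespace PHG

theorem le_maxArcSize {R : Type*} [Ring R] [Finite R] {K : Point R → ℕ} {k n : ℕ}
    (hK : IsProjective K) (h : IsArc K k n) : k ≤ maxArcSize R n := by
  -- The supremum needs an upper bound on the sizes: a projective arc has at most as many points as
  -- the plane.
  refine le_csSup ⟨Nat.card (Point R), ?_⟩ ⟨K, hK, h⟩
  rintro _ ⟨K', hK', rfl, -⟩
  have : Fintype (Point R) := Fintype.ofFinite _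
  rw [pointCount, finsum_mem_univ, finsum_eq_sum_of_fintype, Nat.card_eq_fintype_card,
    ← Finset.card_univ, Finset.card_eq_sum_ones]
  exact Finset.sum_le_sum fun x _ => by rcases hK' x with h | h <;> simp [h]

end PHG

/-- Here `q` is the order of the residue field of `R`; since `q ≥ 2`, the natural number
subtractions `q ^ 4 - q ^ 2 - q` and `q ^ 2 - 1` are never truncated. -/
theorem mainTheorem1 (R : Type*) [Ring R] [Finite R] (hR : IsChainRingOfLengthTwo R)
    (q : ℕ) (hq : Nat.card (R ⧸ Ring.jacobson R) = q) :
    (∃ K : PHG.Point R → ℕ, PHG.IsProjective K ∧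
      PHG.IsArc K (q ^ 4 - q ^ 2 - q) (q ^ 2 - 1)) ∧
    (q : ℤ) * (q + 1) * ((q : ℤ) ^ 2 - 1) - (q : ℤ) ^ 3 ≤ (PHG.maxArcSize R (q ^ 2 - 1) : ℤ) := by
  have hfin : Finite (R ⧸ Ring.jacobson R) := Quotient.finite _
  have : Fintype (R ⧸ Ring.jacobson R) := Fintype.ofFinite _
  obtain ⟨hF, ⟨S⟩⟩ := hR.exists_residueSystem
  have hq2 : 2 ≤ q := by
    rw [← hq, Nat.card_eq_fintype_card]
    exact Fintype.one_lt_card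
  have harc : PHG.IsArc S.arc (q ^ 4 - q ^ 2 - q) (q ^ 2 - 1) := by
    rw [← hq, Nat.card_eq_fintype_card]
    exact S.isArc_arc
  refine ⟨⟨S.arc, S.isProjective_arc, harc⟩, ?_⟩
  have hle : q ^ 2 + q ≤ q ^ 4 := by
    have h1 : q ≤ q ^ 2 := Nat.le_self_pow two_ne_zero q
    nlinarith
  have h : ((q ^ 4 - q ^ 2 - q : ℕ) : ℤ) ≤ PHG.maxArcSize R (q ^ 2 - 1) := by
    exact_mod_cast PHG.le_maxArcSize S.isProjective_arc harc
  rw [Nat.sub_sub, Nat.cast_sub hle] at h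
  push_cast at h
  linarith
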